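/- Let $\mathcal M$ be a maximal ancestral graph (MAG) over a finite vertex set $O$, i.e. a simple graph with directed ($\to$) and bi-directed ($\leftrightarrow$) edges, without directed or almost directed cycles, in which any two distinct non-adjacent vertices are m-separated by some set of vertices. Let $(V_i)_{i\in O}$ be random variables on a standard Borel probability space whose joint law satisfies the causal Markov and faithfulness conditions with respect to $\mathcal M$: for pairwise disjoint $A,B,C\subseteq O$, $V_A$ and $V_B$ are conditionally independent given $V_C$ if and only if $A$ and $B$ are m-separated by $C$ in $\mathcal M$. Let $K\subseteq O$. For $X\in K$, a Markov blanket $\mathrm{MB}_K(X)$ of $X$ relative to $K$ is an inclusion-minimal set $B\subseteq K\setminus\{X\}$ such that $X$ is conditionally independent of $Y$ given $B$ for every $Y\in K\setminus(B\cup\{X\})$. The procedure ConstructUIG outputs the undirected graph $\overline{\mathcal G}_K$ on the vertex set $K$ that is obtained from the graph without edges by adding, for each $X\in K$, the edges $X - Y$ with $Y\in \mathrm{MB}_K(X)$. An undirected independence graph (UIG) of $\mathcal M$ relative to $K$ is an undirected graph $H$ on $K$ such that for all pairwise disjoint $A,B,C\subseteq K$, if $C$ separates $A$ and $B$ in $H$,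 then $C$ m-separates $A$ and $B$ in $\mathcal M$; it is minimal if no graph obtained from $H$ by removing an edge is a UIG of $\mathcal M$ relative to $K$. Then every $X\in K$ has exactly one Markov blanket relative to $K$, and the output $\overline{\mathcal G}_K$ of ConstructUIG is a UIG of $\mathcal M$ relative to $K$ and is moreover a minimal one. Furthermore, $\overline{\mathcal G}_K=(\mathcal M_K)^a$. Here $\mathcal M_K$ is the marginal MAG over $K$: distinct $X,Y\in K$ are adjacent in it if and only if no subset of $K\setminus\{X,Y\}$ m-separates them in $\mathcal M$, and the edge is $X\to Y$ if $X$ is an ancestor of $Y$ in $\mathcal M$, $X\leftarrow Y$ if $Y$ is an ancestor of $X$, and $X\leftrightarrow Y$ otherwise. The augmented graph $(\cdot)^a$ joins two distinct vertices if and only if there is a path between them (possibly a single edge) all of whose non-endpoint vertices are colliders. -/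

import Mathlib

/-- A directed mixed graph on `O`: directed edges `dir x y` (`x → y`) and bi-directed edges
`bi x y` (`x ↔ y`), with no self-loops and at most one edge between two vertices. -/
structure DirectedMixedGraph (O : Type*) where
  dir : O → O → Prop
  bi : O → O → Prop
  bi_symm : ∀ x y, bi x y → bi y x
  dir_irrefl : ∀ x, ¬ dir x x
  bi_irrefl : ∀ x, ¬ bi x x
  dir_asymm : ∀ x y, dir x y → ¬ dir y x
  dir_not_bi : ∀ x y, dir x y → ¬ bi x y

namespace DirectedMixedGraph

variable {O : Type*} (G : DirectedMixedGraph O)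

/-- The adjacency relation: two vertices are adjacent if there is an edge between them. Paths of
the mixed graph are the paths of this simple graph (there are no multiple edges). -/
def skeleton : SimpleGraph O where
  Adj x y := G.dir x y ∨ G.dir y x ∨ G.bi x y
  symm := ⟨fun x y h => by
    rcases h with h | h | h
    · exact Or.inr (Or.inl h)
    · exact Or.inl h
    · exact Or.inr (Or.inr (G.bi_symm x y h))⟩
  loopless := ⟨fun x h => by
    rcases h with h | h | h
    · exact G.dir_irrefl x h
    · exact G.dir_irrefl x h
    · exact G.bi_irrefl x h⟩

/-- The edge between `x` and `y` has an arrowhead at `y`: `x → y` or `x ↔ y`. -/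
def Into (x y : O) : Prop := G.dir x y ∨ G.bi x y

/-- `x` is an ancestor of `y` or equal to `y`
(equivalently, `y` is a descendant of `x` or equal to `x`). -/
def AncEq (x y : O) : Prop := Relation.ReflTransGen G.dir x y

/-- The non-endpoint vertex number `i + 1` of the path `p` is a collider: both edges of `p` at
that vertex have an arrowhead there. Meaningful for `i + 2 ≤ p.length`. -/
def IsColliderAt {x y : O} (p : G.skeleton.Walk x y) (i : ℕ) : Prop :=
  G.Into (p.getVert i) (p.getVert (i + 1)) ∧ G.Into (p.getVert (i + 2)) (p.getVert (i + 1))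

/-- A collider path: every non-endpoint vertex is a collider. -/
def IsColliderPath {x y : O} (p : G.skeleton.Walk x y) : Prop :=
  p.IsPath ∧ ∀ i, i + 2 ≤ p.length → G.IsColliderAt p i

/-- A path that is m-connecting relative to `Z`: non-colliders are not in `Z` and every collider
is in `Z` or has a descendant in `Z`. -/
def IsMConnecting {x y : O} (p : G.skeleton.Walk x y) (Z : Set O) : Prop :=
  p.IsPath ∧ ∀ i, i + 2 ≤ p.length →
    (G.IsColliderAt p i → ∃ z ∈ Z, G.AncEq (p.getVert (i + 1)) z) ∧
    (¬ G.IsColliderAt p i → p.getVert (i + 1) ∉ Z)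

/-- m-separation of the vertex sets `X` and `Y` by `Z` (used for pairwise disjoint sets). -/
def MSep (X Y Z : Set O) : Prop :=
  ∀ x ∈ X, ∀ y ∈ Y, ∀ p : G.skeleton.Walk x y, ¬ G.IsMConnecting p Z

/-- No directed cycle and no almost directed cycle. -/
structure IsAncestral : Prop where
  no_directed_cycle : ∀ x, ¬ Relation.TransGen G.dir x x
  no_almost_directed_cycle : ∀ x y, G.bi x y → ¬ Relation.TransGen G.dir x y

/-- Maximal ancestral graph. -/
structure IsMAG : Prop extends G.IsAncestral where
  maximal : ∀ x y, x ≠ y → ¬ G.skeleton.Adj x y → ∃ Z : Set O, x ∉ Z ∧ y ∉ Z ∧ G.MSep {x} {y} Z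

theorem IsColliderPath.reverse {x y : O} {p : G.skeleton.Walk x y} (h : G.IsColliderPath p) :
    G.IsColliderPath p.reverse := by
  refine ⟨h.1.reverse, fun i hi => ?_⟩
  rw [SimpleGraph.Walk.length_reverse] at hi
  obtain ⟨a, b⟩ := h.2 (p.length - (i + 2)) (by omega)
  unfold IsColliderAt
  simp only [SimpleGraph.Walk.getVert_reverse]
  have e1 : p.length - (i + 2) + 1 = p.length - (i + 1) := by omega
  have e2 : p.length - (i + 2) + 2 = p.length - i := by omega
  rw [e1] at a b
  rw [e2] at b
  exact ⟨b, a⟩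

/-- The augmented graph: two distinct vertices are adjacent iff they are collider connected
(a single edge is a collider path). -/
def augmented : SimpleGraph O where
  Adj x y := x ≠ y ∧ ∃ p : G.skeleton.Walk x y, G.IsColliderPath p
  symm := ⟨fun _ _ h => ⟨h.1.symm, h.2.elim fun p hp => ⟨p.reverse, hp.reverse⟩⟩⟩
  loopless := ⟨fun _ h => h.1 rfl⟩

theorem IsMConnecting.reverse {x y : O} {p : G.skeleton.Walk x y} {Z : Set O}
    (h : G.IsMConnecting p Z) : G.IsMConnecting p.reverse Z := by
  refine ⟨h.1.reverse, fun i hi => ?_⟩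
  rw [SimpleGraph.Walk.length_reverse] at hi
  have key := h.2 (p.length - (i + 2)) (by omega)
  unfold IsColliderAt at key ⊢
  simp only [SimpleGraph.Walk.getVert_reverse]
  have e1 : p.length - (i + 2) + 1 = p.length - (i + 1) := by omega
  have e2 : p.length - (i + 2) + 2 = p.length - i := by omega
  rw [e1, e2, and_comm (a := G.Into _ _)] at key
  exact key

theorem MSep.symm {X Y Z : Set O} (h : G.MSep X Y Z) : G.MSep Y X Z :=
  fun y hy x hx p hp => h x hx y hy p.reverse hp.reverse

theorem IsAncestral.ancEq_antisymm {G : DirectedMixedGraph O} (h : G.IsAncestral) {x y : O}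
    (hxy : G.AncEq x y) (hyx : G.AncEq y x) : x = y := by
  rcases Relation.reflTransGen_iff_eq_or_transGen.1 hxy with e | t
  · exact e.symm
  · exact absurd (t.trans_left hyx) (h.no_directed_cycle x)

/-- `x` and `y` are m-separated in `G` by no subset of `K \ {x, y}`. -/
def Inseparable (K : Set O) (x y : O) : Prop :=
  ∀ Z : Set O, Z ⊆ K \ {x, y} → ¬ G.MSep {x} {y} Z

theorem Inseparable.symm {K : Set O} {x y : O} (h : G.Inseparable K x y) :
    G.Inseparable K y x := fun Z hZ hs => by
  refine h Z ?_ hs.symm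
  rwa [Set.pair_comm]

/-- The marginal of an ancestral graph over `K`: distinct `x, y ∈ K` are adjacent iff no subset of
`K \ {x, y}` m-separates them in `G`; the edge is `x → y` if `x` is an ancestor of `y` in `G`,
`x ← y` if `y` is an ancestor of `x`, and `x ↔ y` if neither is an ancestor of the other. -/
def marginal (hG : G.IsAncestral) (K : Set O) : DirectedMixedGraph K where
  dir x y := x ≠ y ∧ G.Inseparable K x y ∧ G.AncEq x y
  bi x y := x ≠ y ∧ G.Inseparable K x y ∧ ¬ G.AncEq x y ∧ ¬ G.AncEq y x
  bi_symm _ _ h := ⟨h.1.symm, h.2.1.symm, h.2.2.2, h.2.2.1⟩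
  dir_irrefl _ h := h.1 rfl
  bi_irrefl _ h := h.1 rfl
  dir_asymm _ _ h h' := h.1 (Subtype.ext (hG.ancEq_antisymm h.2.2 h'.2.2))
  dir_not_bi _ _ h h' := h'.2.2.1 h.2.2

/-- `H` is an undirected independence graph of `G` relative to `K`: for pairwise disjoint
`X, Y, Z ⊆ K`, if every path of `H` between `X` and `Y` meets `Z`, then `Z` m-separates `X` and `Y`
in `G`. -/
def IsUIG (K : Set O) (H : SimpleGraph K) : Prop :=
  ∀ X Y Z : Set K, Disjoint X Y → Disjoint X Z → Disjoint Y Z →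
    (∀ x ∈ X, ∀ y ∈ Y, ∀ p : H.Walk x y, p.IsPath → ∃ z ∈ Z, z ∈ p.support) →
    G.MSep (Subtype.val '' X) (Subtype.val '' Y) (Subtype.val '' Z)

/-- `H` is a minimal undirected independence graph of `G` relative to `K`: it is one, and
removing any edge introduces a separation that is not an m-separation in `G`. -/
def IsMinimalUIG (K : Set O) (H : SimpleGraph K) : Prop :=
  G.IsUIG K H ∧ ∀ e ∈ H.edgeSet, ¬ G.IsUIG K (H.deleteEdges {e})

end DirectedMixedGraph

section Probability

open MeasureTheory ProbabilityTheory

variable {O Ω : Type*} {E : O → Type*} [∀ i, MeasurableSpace (E i)]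

/-- The σ-algebra generated by the variables `V i`, `i ∈ S`. -/
abbrev sigmaOf (V : ∀ i, Ω → E i) (S : Set O) : MeasurableSpace Ω :=
  ⨆ i ∈ S, MeasurableSpace.comap (V i) inferInstance

variable [mΩ : MeasurableSpace Ω]

theorem sigmaOf_le {V : ∀ i, Ω → E i} (hV : ∀ i, Measurable (V i)) (S : Set O) :
    sigmaOf V S ≤ mΩ :=
  iSup₂_le fun i _ => (hV i).comap_le

variable [StandardBorelSpace Ω] (μ : Measure Ω) [IsFiniteMeasure μ]

/-- The variables in `A` are conditionally independent of those in `B` given those in `C`. -/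
def CondIndepVars {V : ∀ i, Ω → E i} (hV : ∀ i, Measurable (V i)) (A B C : Set O) : Prop :=
  CondIndep (sigmaOf V C) (sigmaOf V A) (sigmaOf V B) (sigmaOf_le hV C) μ

/-- Causal Markov condition: m-separation implies conditional independence. -/
def CausalMarkov (G : DirectedMixedGraph O) {V : ∀ i, Ω → E i} (hV : ∀ i, Measurable (V i)) :
    Prop :=
  ∀ A B C : Set O, Disjoint A B → Disjoint A C → Disjoint B C →
    G.MSep A B C → CondIndepVars μ hV A B C

/-- Causal faithfulness condition: conditional independence implies m-separation. -/
def CausalFaithful (G : DirectedMixedGraph O) {V : ∀ i, Ω → E i} (hV : ∀ i, Measurable (V i)) :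
    Prop :=
  ∀ A B C : Set O, Disjoint A B → Disjoint A C → Disjoint B C →
    CondIndepVars μ hV A B C → G.MSep A B C

/-- `B` is a Markov blanket of `x` relative to `K`: an inclusion-minimal subset of `K \ {x}` given
which `x` is conditionally independent of every remaining variable of `K`. -/
def IsMarkovBlanket {V : ∀ i, Ω → E i} (hV : ∀ i, Measurable (V i)) (K : Set O) (x : O)
    (B : Set O) : Prop :=
  Minimal (fun B : Set O => B ⊆ K \ {x} ∧ ∀ y ∈ K \ (B ∪ {x}), CondIndepVars μ hV {x} {y} B) B

end Probability

/-- Output of the procedure that starts from the graph on `K` without edges and, for every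
`x ∈ K`, adds the edges between `x` and all members of `mb x`. -/
def constructUIG {O : Type*} (K : Set O) (mb : K → Set O) : SimpleGraph K :=
  SimpleGraph.fromRel fun x y => (y : O) ∈ mb x

/-! Everything is compared with one graph on `K`, `independenceGraph`, defined by walks of `G` whose
non-colliders avoid `K` and whose colliders lie in `K` or above it. Walks, unlike paths, can be
concatenated and rerouted. `Conn.exists_isMConnecting` turns them back into m-connecting paths, and
`Conn.exists_conn_ancestors` reroutes at colliders that are not ancestors of the conditioning set.
Together they show that adjacency of `x` and `y` means m-connection given `K \ {x, y}`.

Cutting a connecting walk at its visits to `K \ Z` gives a route in this graph avoiding `Z`, hence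
the UIG property; minimality is the adjacency criterion. The neighbours of `x` form the least set
that separates `x` from the rest of `K`, so by Markov and faithfulness they are the unique Markov
blanket.

For the augmented graph, edges of the marginal correspond to walks whose colliders are ancestors of
the two ends. Collider paths of the marginal concatenate to walks defining an edge of
`independenceGraph`. Conversely, such a walk breaks into a sequence of vertices of `K`, and in a
shortest one every inner vertex is a collider of the marginal. -/

namespace DirectedMixedGraph

variable {O : Type*} {G : DirectedMixedGraph O}

/-! ### Connecting walks and their rerouting -/

variable (G) in
/-- The vertices of `S` and all their ancestors. -/
def ancestors (S : Set O) : Set O := {a | ∃ z ∈ S, G.AncEq a z}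

theorem subset_ancestors (S : Set O) : S ⊆ G.ancestors S :=
  fun a ha => ⟨a, ha, Relation.ReflTransGen.refl⟩

theorem ancestors_mono {S T : Set O} (h : S ⊆ T) : G.ancestors S ⊆ G.ancestors T :=
  fun _ ⟨z, hz, ha⟩ => ⟨z, h hz, ha⟩

theorem AncEq.mem_ancestors {S : Set O} {a b : O} (h : G.AncEq a b) (hb : b ∈ G.ancestors S) :
    a ∈ G.ancestors S := by
  obtain ⟨z, hz, hbz⟩ := hb
  exact ⟨z, hz, Relation.ReflTransGen.trans h hbz⟩

theorem ancestors_subset_ancestors {S T : Set O} (h : S ⊆ G.ancestors T) :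
    G.ancestors S ⊆ G.ancestors T :=
  fun _ ⟨_, hz, ha⟩ => AncEq.mem_ancestors ha (h hz)

variable (G) in
/-- An edge between `a` and `b` whose marks at `a` and `b` are arrowheads iff the respective
boolean is `true`. -/
def MarkedEdge (a : O) (m : Bool) (b : O) (m' : Bool) : Prop :=
  G.skeleton.Adj a b ∧ (m = true ↔ G.Into b a) ∧ (m' = true ↔ G.Into a b)

theorem MarkedEdge.symm {a b : O} {m m' : Bool} (h : G.MarkedEdge a m b m') :
    G.MarkedEdge b m' a m :=
  ⟨h.1.symm, h.2.2, h.2.1⟩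

theorem not_into_of_dir {a b : O} (h : G.dir a b) : ¬ G.Into b a := by
  rintro (h' | h')
  · exact G.dir_asymm _ _ h h'
  · exact G.dir_not_bi _ _ h (G.bi_symm _ _ h')

theorem dir_of_adj_of_not_into {a b : O} (h : G.skeleton.Adj a b) (h' : ¬ G.Into b a) :
    G.dir a b := by
  rcases h with h | h | h
  · exact h
  · exact absurd (Or.inl h) h'
  · exact absurd (Or.inr (G.bi_symm _ _ h)) h'

theorem markedEdge_of_dir {a b : O} (h : G.dir a b) : G.MarkedEdge a false b true :=
  ⟨Or.inl h, by simpa using not_into_of_dir h, ⟨fun _ => Or.inl h, fun _ => rfl⟩⟩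

theorem MarkedEdge.dir_left {a b : O} {m' : Bool} (h : G.MarkedEdge a false b m') : G.dir a b :=
  dir_of_adj_of_not_into h.1 fun hi => by simpa using h.2.1.2 hi

theorem MarkedEdge.dir_right {a b : O} {m : Bool} (h : G.MarkedEdge a m b false) : G.dir b a :=
  h.symm.dir_left

theorem exists_markedEdge {a b : O} (h : G.skeleton.Adj a b) :
    ∃ m m', G.MarkedEdge a m b m' := by
  classical
  exact ⟨decide (G.Into b a), decide (G.Into a b), h, by simp, by simp⟩

/-- The condition on a vertex `b` of a walk between two edges with marks `m` and `m'` at `b`. -/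
def MarkCond (N C : Set O) (m : Bool) (b : O) (m' : Bool) : Prop :=
  (m = true ∧ m' = true → b ∈ C) ∧ (¬ (m = true ∧ m' = true) → b ∈ N)

theorem MarkCond.symm {N C : Set O} {m m' : Bool} {b : O} (h : MarkCond N C m b m') :
    MarkCond N C m' b m :=
  ⟨fun h' => h.1 h'.symm, fun h' => h.2 fun h'' => h' h''.symm⟩

theorem MarkCond.mono {N N' C C' : Set O} {m m' : Bool} {b : O} (hN : N ⊆ N') (hC : C ⊆ C')
    (h : MarkCond N C m b m') : MarkCond N' C' m b m' :=
  ⟨fun h' => hC (h.1 h'), fun h' => hN (h.2 h')⟩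

theorem markCond_collider {N C : Set O} {b : O} (h : b ∈ C) : MarkCond N C true b true :=
  ⟨fun _ => h, fun h' => absurd ⟨rfl, rfl⟩ h'⟩

theorem markCond_tail_left {N C : Set O} {b : O} {m : Bool} (h : b ∈ N) :
    MarkCond N C false b m :=
  ⟨fun h' => by simp at h', fun _ => h⟩

theorem markCond_tail_right {N C : Set O} {b : O} {m : Bool} (h : b ∈ N) :
    MarkCond N C m b false :=
  (markCond_tail_left h).symm

variable (G) in
/-- There is a walk from `a` to `b` with marks `m` at `a` and `m'` at `b` on which all non-colliders
are in `N` and all colliders are in `C`. -/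
inductive Conn (N C : Set O) (a : O) (m : Bool) : O → Bool → Prop
  | edge {b m'} : G.MarkedEdge a m b m' → Conn N C a m b m'
  | snoc {b m₁ m₂ c m₃} : Conn N C a m b m₁ → G.MarkedEdge b m₂ c m₃ →
      MarkCond N C m₁ b m₂ → Conn N C a m c m₃

namespace Conn

variable {N C N' C' : Set O} {a b c : O} {m m' m₁ m₂ m₃ : Bool}

theorem mono (hN : N ⊆ N') (hC : C ⊆ C') (h : G.Conn N C a m b m') : G.Conn N' C' a m b m' := by
  induction h with
  | edge e => exact .edge e
  | snoc _ e hc ih => exact .snoc ih e (hc.mono hN hC)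

theorem trans (h : G.Conn N C a m b m₁) (h' : G.Conn N C b m₂ c m₃) (hc : MarkCond N C m₁ b m₂) :
    G.Conn N C a m c m₃ := by
  induction h' with
  | edge e => exact .snoc h e hc
  | snoc _ e hc' ih => exact .snoc ih e hc'

theorem symm (h : G.Conn N C a m b m') : G.Conn N C b m' a m := by
  induction h with
  | edge e => exact .edge e.symm
  | snoc _ e hc ih => exact (Conn.edge e.symm).trans ih hc.symm

/-- The last vertex is a proper ancestor of a collider or of the first vertex if the last edge
has a tail there. -/
theorem exists_transGen_of_tail (h : G.Conn N C a m b m') (hm : m' = false) :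
    ∃ c ∈ insert a C, Relation.TransGen G.dir b c := by
  induction h with
  | edge e => subst hm; exact ⟨a, Or.inl rfl, .single e.dir_right⟩
  | @snoc b m₁ m₂ c m₃ _ e hc ih =>
    subst hm
    cases hm₁ : m₁ with
    | false =>
      obtain ⟨d, hd, hbd⟩ := ih hm₁
      exact ⟨d, hd, .head e.dir_right hbd⟩
    | true =>
      have : m₂ = true := e.2.1.2 (Or.inl e.dir_right)
      exact ⟨b, Or.inr (hc.1 ⟨hm₁, this⟩), .single e.dir_right⟩

/-- A non-collider has a tail on one side; following the walk that way along directed edges ends at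
a collider or at an endpoint. -/
theorem inter_ancestors (h : G.Conn N C a m b m') :
    G.Conn (N ∩ G.ancestors (insert a (insert b C))) C a m b m' := by
  induction h with
  | edge e => exact .edge e
  | @snoc b m₁ m₂ c m₃ h e hc ih =>
    have hb : b ∈ G.ancestors (insert a (insert c C)) := by
      cases hm₁ : m₁ with
      | false =>
        obtain ⟨d, hd, hbd⟩ := h.exists_transGen_of_tail hm₁
        refine ⟨d, ?_, hbd.to_reflTransGen⟩
        rcases hd with hd | hd
        · exact Or.inl hd
        · exact Or.inr (Or.inr hd)
      | true =>
        cases hm₂ : m₂ with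
        | false =>
          subst hm₂
          exact ⟨c, by simp, .single e.dir_left⟩
        | true => exact subset_ancestors _ (Or.inr (Or.inr (hc.1 ⟨hm₁, hm₂⟩)))
    have hsub : G.ancestors (insert a (insert b C)) ⊆ G.ancestors (insert a (insert c C)) := by
      apply ancestors_subset_ancestors
      rintro d (rfl | rfl | hd)
      · exact subset_ancestors _ (by simp)
      · exact hb
      · exact subset_ancestors _ (Or.inr (Or.inr hd))
    exact .snoc (ih.mono (Set.inter_subset_inter_right _ hsub) subset_rfl) e
      ⟨hc.1, fun h' => ⟨hc.2 h', hb⟩⟩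

end Conn

/-- A directed path starting outside the ancestors of `Z` never meets `Z`, and it has no colliders.
-/
theorem AncEq.eq_or_conn {Z C : Set O} {b t : O} (h : G.AncEq b t) (hb : b ∉ G.ancestors Z) :
    b = t ∨ G.Conn Zᶜ C b false t true := by
  induction h using Relation.ReflTransGen.head_induction_on with
  | refl => exact Or.inl rfl
  | @head a c hac _ ih =>
    have hc : c ∉ G.ancestors Z := fun hc => hb (AncEq.mem_ancestors (.single hac) hc)
    right
    rcases ih hc with rfl | h
    · exact .edge (markedEdge_of_dir hac)
    · exact (Conn.edge (markedEdge_of_dir hac)).trans h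
        (markCond_tail_right fun hcZ => hc (subset_ancestors _ hcZ))

theorem exists_closest_descendant {K C : Set O} {b : O} (h : b ∈ G.ancestors K) :
    ∃ k ∈ K, b = k ∨ (b ∉ K ∧ G.Conn Kᶜ C b false k true) := by
  obtain ⟨t, ht, h⟩ := h
  induction h using Relation.ReflTransGen.head_induction_on with
  | refl => exact ⟨t, ht, Or.inl rfl⟩
  | @head a c hac _ ih =>
    by_cases ha : a ∈ K
    · exact ⟨a, ha, Or.inl rfl⟩
    obtain ⟨k, hk, rfl | ⟨hc, h⟩⟩ := ih
    · exact ⟨c, hk, Or.inr ⟨ha, .edge (markedEdge_of_dir hac)⟩⟩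
    · exact ⟨k, hk, Or.inr ⟨ha, (Conn.edge (markedEdge_of_dir hac)).trans h
        (markCond_tail_right hc)⟩⟩

/-- If all colliders of a walk from `x` to `T` are in `Z ∪ T ∪ {x}` or ancestors thereof, then some
walk from `x` to `T` has only colliders that are in `Z` or ancestors of `Z`. -/
theorem Conn.exists_conn_ancestors {N C Z T : Set O} {x y : O} {m m' : Bool}
    (h : G.Conn N C x m y m') (hN : N ⊆ Zᶜ) (hC : C ⊆ G.ancestors (insert x (Z ∪ T)))
    (hy : y ∈ T) : ∃ w ∈ T, ∃ m m', G.Conn Zᶜ (G.ancestors Z) x m w m' := by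
  -- Either `T` has already been reached, or the walk so far has been repaired. The mark at `x` is
  -- left free because a repair may restart at `x`.
  suffices H : (∃ w ∈ T, ∃ m m', G.Conn Zᶜ (G.ancestors Z) x m w m') ∨
      ∃ m, G.Conn Zᶜ (G.ancestors Z) x m y m' by
    rcases H with H | ⟨m, H⟩
    · exact H
    · exact ⟨y, hy, m, m', H⟩
  clear hy
  induction h with
  | edge e => exact Or.inr ⟨_, .edge e⟩
  | @snoc b m₁ m₂ c m₃ h e hc ih =>
    rcases ih with ih | ⟨m, ih⟩
    · exact Or.inl ih
    by_cases hm : m₁ = true ∧ m₂ = true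
    · by_cases hbZ : b ∈ G.ancestors Z
      · exact Or.inr ⟨m, .snoc ih e ⟨fun _ => hbZ, fun h => absurd hm h⟩⟩
      have hbZ' : b ∉ Z := fun h => hbZ (subset_ancestors _ h)
      obtain ⟨t, ht, hbt⟩ := hC (hc.1 hm)
      -- A bad collider above `x` lets the prefix be replaced by the reversed directed path from
      -- `x`; one above `T` lets the walk descend to `T` and stop.
      rcases ht with rfl | ht | ht
      · right
        rcases hbt.eq_or_conn hbZ with rfl | h'
        · exact ⟨_, .edge e⟩
        · exact ⟨_, .snoc h'.symm e (markCond_tail_left hbZ')⟩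
      · exact absurd ⟨t, ht, hbt⟩ hbZ
      · left
        refine ⟨t, ht, ?_⟩
        rcases hbt.eq_or_conn hbZ with rfl | h'
        · exact ⟨_, _, ih⟩
        · exact ⟨_, _, ih.trans h' (markCond_tail_right hbZ')⟩
    · exact Or.inr ⟨m, .snoc ih e ⟨fun h => absurd h hm, fun h => hN (hc.2 h)⟩⟩

end DirectedMixedGraph

/-! ### From connecting walks to m-connecting paths by removing loops -/

theorem SimpleGraph.exists_walk_getVert_eq {V : Type*} (H : SimpleGraph V) (f : ℕ → V) (n : ℕ)
    (hf : ∀ i < n, H.Adj (f i) (f (i + 1))) :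
    ∃ p : H.Walk (f 0) (f n), p.length = n ∧ ∀ i ≤ n, p.getVert i = f i := by
  induction n generalizing f with
  | zero => exact ⟨.nil, rfl, fun i hi => by simp [Nat.le_zero.1 hi]⟩
  | succ n ih =>
    obtain ⟨p, hp, hp'⟩ := ih (fun i => f (i + 1)) fun i hi => hf (i + 1) (by omega)
    refine ⟨.cons (hf 0 (by omega)) p, by simp [hp], fun i hi => ?_⟩
    cases i with
    | zero => simp
    | succ i => simpa using hp' i (by omega)

theorem SimpleGraph.exists_path_getVert_eq {V : Type*} (H : SimpleGraph V) (f : ℕ → V) (n : ℕ)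
    (hf : ∀ i < n, H.Adj (f i) (f (i + 1))) (hinj : Set.InjOn f {i | i ≤ n}) :
    ∃ p : H.Walk (f 0) (f n), p.IsPath ∧ p.length = n ∧ ∀ i ≤ n, p.getVert i = f i := by
  obtain ⟨p, hp, hp'⟩ := H.exists_walk_getVert_eq f n hf
  refine ⟨p, ?_, hp, hp'⟩
  rw [← SimpleGraph.Walk.IsPath.getVert_injOn_iff]
  intro i hi j hj hij
  simp only [Set.mem_ofPred_eq, hp] at hi hj
  rw [hp' i hi, hp' j hj] at hij
  exact hinj hi hj hij

/-- The sequence `f` without the part from index `i` to index `j`. -/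
def cutSeq {α : Type*} (f : ℕ → α) (i j : ℕ) (k : ℕ) : α := if k ≤ i then f k else f (k + (j - i))

theorem cutSeq_of_le {α : Type*} (f : ℕ → α) {i j k : ℕ} (h : k ≤ i) :
    cutSeq f i j k = f k := if_pos h

theorem cutSeq_of_ge {α : Type*} {f : ℕ → α} {i j k : ℕ} (hf : f i = f j) (hij : i < j)
    (h : i ≤ k) : cutSeq f i j k = f (k + (j - i)) := by
  rcases h.eq_or_lt with rfl | h
  · rw [cutSeq_of_le _ le_rfl, hf]
    congr 1
    omega
  · exact if_neg (by omega)

namespace DirectedMixedGraph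

variable {O : Type*} {G : DirectedMixedGraph O}

variable (G) in
/-- The first `n + 1` terms of `f` form a walk whose colliders are in `Z` or ancestors of `Z` and
whose non-colliders are not in `Z`. -/
def IsConnectingSeq (Z : Set O) (f : ℕ → O) (n : ℕ) : Prop :=
  (∀ i < n, G.skeleton.Adj (f i) (f (i + 1))) ∧ ∀ i, i + 2 ≤ n →
    (G.Into (f i) (f (i + 1)) ∧ G.Into (f (i + 2)) (f (i + 1)) → f (i + 1) ∈ G.ancestors Z) ∧
    (¬ (G.Into (f i) (f (i + 1)) ∧ G.Into (f (i + 2)) (f (i + 1))) → f (i + 1) ∉ Z)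

theorem Conn.exists_isConnectingSeq {Z : Set O} {a b : O} {m m' : Bool}
    (h : G.Conn Zᶜ (G.ancestors Z) a m b m') :
    ∃ n f, G.IsConnectingSeq Z f (n + 1) ∧ f 0 = a ∧ f (n + 1) = b ∧
      (m' = true ↔ G.Into (f n) (f (n + 1))) := by
  induction h with
  | @edge b m' e =>
    refine ⟨0, fun i => if i = 0 then a else b, ⟨?_, fun i hi => by omega⟩, by simp, by simp,
      by simpa using e.2.2⟩
    intro i hi
    obtain rfl : i = 0 := by omega
    simpa using e.1
  | @snoc b m₁ m₂ c m₃ h e hc ih =>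
    obtain ⟨n, f, hf, h0, hn, hm⟩ := ih
    let g : ℕ → O := fun i => if i ≤ n + 1 then f i else c
    have hg : ∀ i ≤ n + 1, g i = f i := fun i hi => if_pos hi
    have hgc : g (n + 1 + 1) = c := if_neg (by omega)
    have hgb : g (n + 1) = b := by rw [hg _ le_rfl, hn]
    refine ⟨n + 1, g, ⟨?_, ?_⟩, by rw [hg 0 (by omega), h0], hgc, by rw [hgb, hgc]; exact e.2.2⟩
    · intro i hi
      rcases Nat.lt_succ_iff_lt_or_eq.1 hi with hi | rfl
      · rw [hg i (by omega), hg (i + 1) (by omega)]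
        exact hf.1 i hi
      · rw [hgb, hgc]
        exact e.1
    · intro i hi
      by_cases hi' : i + 2 ≤ n + 1
      · rw [hg i (by omega), hg (i + 1) (by omega), hg (i + 2) hi']
        exact hf.2 i hi'
      · obtain rfl : i = n := by omega
        have hgc' : g (i + 2) = c := hgc
        rw [hg i (by omega), hgb, hgc', ← hn, ← hm, hn, ← e.2.1]
        exact hc

/-- On a connecting sequence a vertex that occurs twice is an ancestor of `Z` if the sequence
leaves the first occurrence along a tail and enters the second one along an arrowhead. -/
theorem IsConnectingSeq.mem_ancestors_of_loop {Z : Set O} {f : ℕ → O} {n i j : ℕ}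
    (hf : G.IsConnectingSeq Z f n) (hij : i < j) (hjn : j < n) (heq : f i = f j)
    (hdir : G.dir (f i) (f (i + 1))) (hj : G.Into (f (j + 1)) (f j)) :
    f i ∈ G.ancestors Z := by
  by_contra hZ
  -- Until a collider occurs the sequence runs along directed edges, so the first collider is a
  -- descendant of `f i` and an ancestor of `Z`.
  have key : ∀ l, i + l + 1 ≤ j →
      G.AncEq (f i) (f (i + l + 1)) ∧ G.dir (f (i + l)) (f (i + l + 1)) := by
    intro l
    induction l with
    | zero => exact fun _ => ⟨.single hdir, hdir⟩
    | succ l ih =>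
      intro hl
      obtain ⟨h1, h2⟩ := ih (by omega)
      have h3 : G.dir (f (i + l + 1)) (f (i + l + 2)) := by
        refine dir_of_adj_of_not_into (hf.1 _ (by omega)) fun hi => hZ ?_
        exact h1.mem_ancestors ((hf.2 (i + l) (by omega)).1 ⟨Or.inl h2, hi⟩)
      exact ⟨Relation.ReflTransGen.tail h1 h3, h3⟩
  obtain ⟨l, rfl⟩ : ∃ l, j = i + l + 1 := ⟨j - i - 1, by omega⟩
  obtain ⟨h1, h2⟩ := key l le_rfl
  exact hZ (heq ▸ (hf.2 (i + l) (by omega)).1 ⟨Or.inl h2, hj⟩)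

/-- Only the junction needs an argument. A non-collider there was one at one of the two visits; a
new collider was one at the first visit, or the loop left it by a tail and `mem_ancestors_of_loop`
applies. -/
theorem IsConnectingSeq.cut {Z : Set O} {f : ℕ → O} {n i j : ℕ}
    (hf : G.IsConnectingSeq Z f n) (hij : i < j) (hjn : j ≤ n) (heq : f i = f j) :
    G.IsConnectingSeq Z (cutSeq f i j) (n - (j - i)) := by
  refine ⟨fun k hk => ?_, fun k hk => ?_⟩
  · rcases lt_or_ge k i with h | h
    · rw [cutSeq_of_le f h.le, cutSeq_of_le f h]
      exact hf.1 k (by omega)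
    · rw [cutSeq_of_ge heq hij h, cutSeq_of_ge heq hij (by omega)]
      have := hf.1 (k + (j - i)) (by omega)
      rwa [show k + (j - i) + 1 = k + 1 + (j - i) by omega] at this
  · rcases lt_trichotomy (k + 1) i with h | h | h
    · rw [cutSeq_of_le f (by omega), cutSeq_of_le f (by omega), cutSeq_of_le f (by omega)]
      exact hf.2 k (by omega)
    · have hk2 : cutSeq f i j (k + 2) = f (j + 1) := by
        rw [cutSeq_of_ge heq hij (by omega)]
        congr 1
        omega
      rw [hk2, cutSeq_of_le f (by omega), cutSeq_of_le f (by omega)]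
      subst h
      have hl := hf.2 k (by omega)
      obtain ⟨j, rfl⟩ : ∃ j', j = j' + 1 := ⟨j - 1, by omega⟩
      have hr := hf.2 j (by omega)
      rw [← heq] at hr
      refine ⟨fun ⟨h1, h2⟩ => ?_, fun h => ?_⟩
      · by_cases h3 : G.Into (f (k + 2)) (f (k + 1))
        · exact hl.1 ⟨h1, h3⟩
        · exact hf.mem_ancestors_of_loop hij (by omega) heq
            (dir_of_adj_of_not_into (hf.1 _ (by omega)) h3) (heq ▸ h2)
      · by_cases h1 : G.Into (f k) (f (k + 1))
        · exact hr.2 fun h' => h ⟨h1, h'.2⟩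
        · exact hl.2 fun h' => h1 h'.1
    · rw [cutSeq_of_ge heq hij (by omega), cutSeq_of_ge heq hij (by omega),
        cutSeq_of_ge heq hij (by omega)]
      have := hf.2 (k + (j - i)) (by omega)
      rwa [show k + (j - i) + 1 = k + 1 + (j - i) by omega,
        show k + (j - i) + 2 = k + 2 + (j - i) by omega] at this

/-- A connecting sequence of least length repeats no vertex, since a loop could be cut. -/
theorem Conn.exists_isMConnecting {Z : Set O} {a b : O} {m m' : Bool} (hab : a ≠ b)
    (h : G.Conn Zᶜ (G.ancestors Z) a m b m') :
    ∃ p : G.skeleton.Walk a b, G.IsMConnecting p Z := by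
  classical
  have hex : ∃ n f, G.IsConnectingSeq Z f n ∧ f 0 = a ∧ f n = b := by
    obtain ⟨n, f, hf, h0, hn, -⟩ := h.exists_isConnectingSeq
    exact ⟨n + 1, f, hf, h0, hn⟩
  obtain ⟨f, hf, h0, hn⟩ := Nat.find_spec hex
  have hmin : ∀ k < Nat.find hex, ¬ _ := fun k hk => Nat.find_min hex hk
  generalize Nat.find hex = n at *
  have hne : ∀ i j, i < j → j ≤ n → f i ≠ f j := by
    intro i j hij hjn heq
    refine hmin (n - (j - i)) (by omega)
      ⟨cutSeq f i j, hf.cut hij hjn heq, by rw [cutSeq_of_le f (by omega), h0], ?_⟩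
    rw [cutSeq_of_ge heq hij (by omega), ← hn]
    congr 1
    omega
  have hinj : Set.InjOn f {i | i ≤ n} := by
    intro i hi j hj hij
    rcases lt_trichotomy i j with h | h | h
    · exact absurd hij (hne i j h hj)
    · exact h
    · exact absurd hij.symm (hne j i h hi)
  obtain ⟨p, hp, hlen, hv⟩ := G.skeleton.exists_path_getVert_eq f n hf.1 hinj
  subst h0 hn
  refine ⟨p, hp, fun i hi => ?_⟩
  unfold IsColliderAt
  rw [hv i (by omega), hv (i + 1) (by omega), hv (i + 2) (by omega)]
  exact hf.2 i (by omega)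

/-- A path does not revisit its endpoints, so its non-colliders avoid `a` and `b` as well as `Z`. -/
theorem IsMConnecting.exists_conn {Z : Set O} {a b : O} {p : G.skeleton.Walk a b} (hab : a ≠ b)
    (hp : G.IsMConnecting p Z) :
    ∃ m m', G.Conn (Z ∪ {a, b})ᶜ (G.ancestors Z) a m b m' := by
  have key : ∀ k, k + 1 ≤ p.length → ∃ m m', G.Conn (Z ∪ {a, b})ᶜ (G.ancestors Z) a m
      (p.getVert (k + 1)) m' ∧ (m' = true ↔ G.Into (p.getVert k) (p.getVert (k + 1))) := by
    intro k
    induction k with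
    | zero =>
      intro hk
      obtain ⟨m, m', e⟩ := exists_markedEdge (p.adj_getVert_succ (i := 0) (by omega))
      refine ⟨m, m', ?_, e.2.2⟩
      simp only [SimpleGraph.Walk.getVert_zero] at e
      exact .edge e
    | succ k ih =>
      intro hk
      obtain ⟨m, m₁, h, hm₁⟩ := ih (by omega)
      obtain ⟨m₂, m', e⟩ := exists_markedEdge (p.adj_getVert_succ (i := k + 1) (by omega))
      refine ⟨m, m', .snoc h e ?_, e.2.2⟩
      obtain ⟨hc, hn⟩ := hp.2 k hk
      have hne : ∀ l, l ≤ p.length → p.getVert (k + 1) = p.getVert l → k + 1 = l :=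
        fun l hl h => hp.1.getVert_injOn (by simp only [Set.mem_ofPred_eq]; omega) hl h
      unfold MarkCond
      rw [hm₁, e.2.1]
      refine ⟨hc, fun h => ?_⟩
      rintro (hZ | ha | hb)
      · exact hn h hZ
      · have := hne 0 (by omega) (by rw [ha, p.getVert_zero])
        omega
      · have := hne p.length le_rfl (by rw [hb, p.getVert_length])
        omega
  have hlen : p.length ≠ 0 := fun h => hab (SimpleGraph.Walk.eq_of_length_eq_zero h)
  obtain ⟨m, m', h, -⟩ := key (p.length - 1) (by omega)
  rw [show p.length - 1 + 1 = p.length by omega, p.getVert_length] at h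
  exact ⟨m, m', h⟩

theorem not_mSep_singleton_iff {Z : Set O} {a b : O} :
    ¬ G.MSep {a} {b} Z ↔ ∃ p : G.skeleton.Walk a b, G.IsMConnecting p Z := by
  simp [MSep]

end DirectedMixedGraph

/-! ### The independence graph on `K`: UIG property, minimality, neighbourhoods -/

namespace DirectedMixedGraph

variable {O : Type*} {G : DirectedMixedGraph O}

theorem not_mSep_of_conn {N C Z : Set O} {a b : O} {m m' : Bool} (hab : a ≠ b)
    (hN : N ⊆ Zᶜ) (hC : C ⊆ G.ancestors (insert a (Z ∪ {b})))
    (h : G.Conn N C a m b m') : ¬ G.MSep {a} {b} Z := by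
  obtain ⟨_, rfl, m, m', h⟩ := h.exists_conn_ancestors hN hC rfl
  exact not_mSep_singleton_iff.2 (h.exists_isMConnecting hab)

variable (G) in
/-- The graph on `K` joining two vertices if a walk of `G` connects them on which all non-colliders
are outside `K` and all colliders are in `K` or ancestors of `K`. -/
def independenceGraph (K : Set O) : SimpleGraph K where
  Adj x y := x ≠ y ∧ ∃ m m', G.Conn Kᶜ (G.ancestors K) x m y m'
  symm := ⟨fun _ _ ⟨h, m, m', h'⟩ => ⟨h.symm, m', m, h'.symm⟩⟩
  loopless := ⟨fun _ h => h.1 rfl⟩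

theorem subset_insert_diff_pair_union (K : Set O) (x y : O) :
    K ⊆ insert x (K \ {x, y} ∪ {y}) := by
  intro z hz
  by_cases hx : z = x
  · exact Or.inl hx
  by_cases hy : z = y
  · exact Or.inr (Or.inr hy)
  exact Or.inr (Or.inl ⟨hz, by simp [hx, hy]⟩)

theorem independenceGraph_adj_iff {K : Set O} {x y : K} (hxy : x ≠ y) :
    (G.independenceGraph K).Adj x y ↔ ¬ G.MSep {(x : O)} {(y : O)} (K \ {(x : O), (y : O)}) := by
  have hne : (x : O) ≠ y := fun h => hxy (Subtype.ext h)
  constructor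
  · rintro ⟨-, m, m', h⟩
    exact not_mSep_of_conn hne (Set.compl_subset_compl.2 Set.sdiff_subset)
      (ancestors_mono (subset_insert_diff_pair_union K x y)) h
  · intro h
    obtain ⟨p, hp⟩ := not_mSep_singleton_iff.1 h
    obtain ⟨m, m', h⟩ := hp.exists_conn hne
    refine ⟨hxy, m, m', h.mono (Set.compl_subset_compl.2 fun z hz => ?_)
      (ancestors_mono Set.sdiff_subset)⟩
    by_cases hz' : z ∈ ({(x : O), (y : O)} : Set O)
    · exact Or.inr hz'
    · exact Or.inl ⟨hz, hz'⟩

/-- The walk is cut at its visits to `K \ Z`. Any vertex of `K` inside a piece lies in `Z`, hence is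
a collider, so each piece gives an edge or returns to its start. -/
theorem Conn.reflTransGen_independenceGraph {K Z : Set O} {x y : K} {m m' : Bool}
    (h : G.Conn Zᶜ (G.ancestors K) x m y m') (hy : (y : O) ∉ Z) :
    Relation.ReflTransGen (fun a b : K => (G.independenceGraph K).Adj a b ∧ (b : O) ∉ Z) x y := by
  have step : ∀ {w : K} {b : O} {m₁ m₂ : Bool}, Relation.ReflTransGen
      (fun a b : K => (G.independenceGraph K).Adj a b ∧ (b : O) ∉ Z) x w →
      G.Conn Kᶜ (G.ancestors K) w m₁ b m₂ → ∀ hb : b ∈ K, b ∉ Z → Relation.ReflTransGen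
      (fun a b : K => (G.independenceGraph K).Adj a b ∧ (b : O) ∉ Z) x ⟨b, hb⟩ := by
    intro w b m₁ m₂ hw hc hb hbZ
    by_cases hwb : w = ⟨b, hb⟩
    · exact hwb ▸ hw
    · exact hw.tail ⟨⟨hwb, _, _, hc⟩, hbZ⟩
  -- Here `w` is the latest cut point, and the piece from `w` to `b` is still open.
  suffices H : ∀ (b : O) (m' : Bool), G.Conn Zᶜ (G.ancestors K) x m b m' → ∃ w : K,
      Relation.ReflTransGen (fun a b : K => (G.independenceGraph K).Adj a b ∧ (b : O) ∉ Z) x w ∧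
      ∃ m₁, G.Conn Kᶜ (G.ancestors K) w m₁ b m' by
    obtain ⟨w, hw, m₁, hc⟩ := H y m' h
    exact step hw hc y.2 hy
  intro b m' h
  induction h with
  | edge e => exact ⟨x, .refl, m, .edge e⟩
  | @snoc b m₁ m₂ c m₃ h e hc ih =>
    obtain ⟨w, hw, m₀, hwb⟩ := ih
    by_cases hb : b ∈ K
    · by_cases hbZ : b ∈ Z
      · exact ⟨w, hw, m₀, .snoc hwb e ⟨fun _ => subset_ancestors _ hb,
          fun h => absurd hbZ (hc.2 h)⟩⟩
      · exact ⟨⟨b, hb⟩, step hw hwb hb hbZ, m₂, .edge e⟩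
    · exact ⟨w, hw, m₀, .snoc hwb e ⟨hc.1, fun _ => hb⟩⟩

theorem reflTransGen_of_not_mSep {K Z : Set O} {x y : K} (hZ : Z ⊆ K) (hxy : x ≠ y)
    (hy : (y : O) ∉ Z) (h : ¬ G.MSep {(x : O)} {(y : O)} Z) :
    Relation.ReflTransGen (fun a b : K => (G.independenceGraph K).Adj a b ∧ (b : O) ∉ Z) x y := by
  obtain ⟨p, hp⟩ := not_mSep_singleton_iff.1 h
  obtain ⟨m, m', h⟩ := hp.exists_conn fun h => hxy (Subtype.ext h)
  exact (h.mono (Set.compl_subset_compl.2 Set.subset_union_left)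
    (ancestors_mono hZ)).reflTransGen_independenceGraph hy

theorem isUIG_independenceGraph (K : Set O) : G.IsUIG K (G.independenceGraph K) := by
  classical
  rintro X Y Z hXY hXZ hYZ hsep _ ⟨x, hx, rfl⟩ _ ⟨y, hy, rfl⟩ p hp
  have hmem : ∀ {w : K}, (w : O) ∈ Subtype.val '' Z ↔ w ∈ Z := fun {w} => by simp
  have hxZ := Set.disjoint_left.1 hXZ hx
  have hr := reflTransGen_of_not_mSep (G := G) (K := K) (x := x) (y := y)
    (Subtype.coe_image_subset K Z) (fun h => Set.disjoint_left.1 hXY hx (h ▸ hy))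
    (by rw [hmem]; exact Set.disjoint_left.1 hYZ hy)
    (not_mSep_singleton_iff.2 ⟨p, hp⟩)
  have key : ∃ q : (G.independenceGraph K).Walk x y, ∀ z ∈ q.support, z ∉ Z := by
    clear hp p hy
    induction hr with
    | refl => exact ⟨.nil, by simpa using hxZ⟩
    | tail _ h ih =>
      obtain ⟨q, hq⟩ := ih
      refine ⟨q.concat h.1, fun z hz => ?_⟩
      rw [SimpleGraph.Walk.support_concat] at hz
      rcases (by simpa using hz : z ∈ q.support ∨ z = _) with hz | rfl
      · exact hq z hz
      · rw [← hmem]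
        exact h.2
  obtain ⟨q, hq⟩ := key
  obtain ⟨z, hz, hzq⟩ := hsep x hx y hy q.bypass q.bypass_isPath
  exact hq z (q.support_bypass_subset_support hzq) hz

theorem isMinimalUIG_independenceGraph (K : Set O) :
    G.IsMinimalUIG K (G.independenceGraph K) := by
  refine ⟨isUIG_independenceGraph K, fun e he hU => ?_⟩
  induction e using Sym2.ind with
  | _ x y =>
  rw [SimpleGraph.mem_edgeSet] at he
  have hxy : x ≠ y := he.1
  -- Without the edge, every path from `x` to `y` has an inner vertex, so all other vertices of `K`
  -- together separate them.
  have h := hU {x} {y} {x, y}ᶜ (by simpa using hxy) (by simp) (by simp) ?_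
  · rw [independenceGraph_adj_iff hxy] at he
    apply he
    convert h using 1
    · simp
    · simp
    · ext z
      constructor
      · rintro ⟨hz, hz'⟩
        exact ⟨⟨z, hz⟩, by simpa [Subtype.ext_iff] using hz', rfl⟩
      · rintro ⟨z, hz, rfl⟩
        exact ⟨z.2, by simpa [Subtype.ext_iff] using hz⟩
  · intro x' hx y' hy p _
    rw [Set.mem_singleton_iff] at hx hy
    subst x' y'
    by_contra! hp
    obtain ⟨w, hadj, q, rfl⟩ := SimpleGraph.Walk.exists_eq_cons_of_ne hxy p
    have hw := hp w
    rw [SimpleGraph.deleteEdges_adj] at hadj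
    by_cases hwx : w = x
    · exact hadj.1.ne hwx.symm
    by_cases hwy : w = y
    · exact hadj.2 (by simp [hwy])
    · exact hw (by simp [hwx, hwy]) (by simp)

/-- If `y` were outside `B`, the walk behind the edge could be rerouted, with `T` the rest of `K`,
to connect `x` given `B` to some vertex of `T`. -/
theorem mem_of_forall_mSep {K B : Set O} {x y : K} (hB : B ⊆ K \ {(x : O)})
    (hsep : ∀ w ∈ K \ (B ∪ {(x : O)}), G.MSep {(x : O)} {w} B)
    (h : (G.independenceGraph K).Adj x y) : (y : O) ∈ B := by
  by_contra hy
  obtain ⟨hxy, m, m', h⟩ := h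
  have hK : K ⊆ insert (x : O) (B ∪ K \ (B ∪ {(x : O)})) := by
    intro z hz
    by_cases hx : z = x
    · exact Or.inl hx
    by_cases hzB : z ∈ B
    · exact Or.inr (Or.inl hzB)
    · exact Or.inr (Or.inr ⟨hz, by simp [hx, hzB]⟩)
  obtain ⟨w, hw, m, m', h⟩ := h.exists_conn_ancestors (T := K \ (B ∪ {(x : O)}))
    (Set.compl_subset_compl.2 (hB.trans Set.sdiff_subset)) (ancestors_mono hK)
    ⟨y.2, by simp [hy, Subtype.coe_inj, hxy.symm]⟩
  have hxw : (x : O) ≠ w := fun h => hw.2 (Or.inr h.symm)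
  exact not_mSep_singleton_iff.2 (h.exists_isMConnecting hxw) (hsep w hw)

/-- A connection would give a route in the graph avoiding all neighbours of `x`, but its first step
lands on one. -/
theorem mSep_neighborSet {K : Set O} {x : K} {y : O}
    (hy : y ∈ K \ (Subtype.val '' (G.independenceGraph K).neighborSet x ∪ {(x : O)})) :
    G.MSep {(x : O)} {y} (Subtype.val '' (G.independenceGraph K).neighborSet x) := by
  by_contra h
  obtain ⟨hyK, hy⟩ := hy
  have hxy : x ≠ ⟨y, hyK⟩ := fun h => hy (Or.inr (congrArg Subtype.val h).symm)
  have hr := reflTransGen_of_not_mSep (G := G) (K := K) (x := x) (y := ⟨y, hyK⟩)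
    (Subtype.coe_image_subset K _) hxy (fun h => hy (Or.inl h)) h
  rcases hr.cases_head with h | ⟨b, hb, -⟩
  · exact hxy h
  · exact hb.2 ⟨b, hb.1, rfl⟩

end DirectedMixedGraph

/-! ### Markov blankets as neighbourhoods -/

section Probability

open MeasureTheory ProbabilityTheory DirectedMixedGraph

variable {O Ω : Type*} {E : O → Type*} [∀ i, MeasurableSpace (E i)] [MeasurableSpace Ω]
  [StandardBorelSpace Ω] {μ : Measure Ω} [IsFiniteMeasure μ]

theorem isMarkovBlanket_iff {G : DirectedMixedGraph O} {V : ∀ i, Ω → E i}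
    {hV : ∀ i, Measurable (V i)} (hMarkov : CausalMarkov μ G hV)
    (hFaithful : CausalFaithful μ G hV) {K : Set O} (x : K) (B : Set O) :
    IsMarkovBlanket μ hV K x B ↔ B = Subtype.val '' (G.independenceGraph K).neighborSet x := by
  have hiff : ∀ B ⊆ K \ {(x : O)}, ∀ y ∈ K \ (B ∪ {(x : O)}),
      (CondIndepVars μ hV {(x : O)} {y} B ↔ G.MSep {(x : O)} {y} B) := by
    intro B hB y hy
    have h1 : Disjoint {(x : O)} {y} :=
      Set.disjoint_singleton.2 fun h => hy.2 (Or.inr h.symm)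
    have h2 : Disjoint {(x : O)} B := Set.disjoint_singleton_left.2 fun h => (hB h).2 rfl
    have h3 : Disjoint {y} B := Set.disjoint_singleton_left.2 fun h => hy.2 (Or.inl h)
    exact ⟨hFaithful _ _ _ h1 h2 h3, hMarkov _ _ _ h1 h2 h3⟩
  have hN : Subtype.val '' (G.independenceGraph K).neighborSet x ⊆ K \ {(x : O)} := by
    rintro _ ⟨y, hy, rfl⟩
    exact ⟨y.2, fun h => hy.1 (Subtype.ext h.symm)⟩
  -- Being least, not merely minimal, is what makes the blanket unique.
  have hleast : IsLeast {B : Set O | B ⊆ K \ {(x : O)} ∧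
      ∀ y ∈ K \ (B ∪ {(x : O)}), CondIndepVars μ hV {(x : O)} {y} B}
      (Subtype.val '' (G.independenceGraph K).neighborSet x) := by
    refine ⟨⟨hN, fun y hy => (hiff _ hN y hy).2 (mSep_neighborSet hy)⟩, ?_⟩
    rintro B ⟨hB, hsep⟩ _ ⟨y, hy, rfl⟩
    exact mem_of_forall_mSep hB (fun w hw => (hiff B hB w hw).1 (hsep w hw)) hy
  exact hleast.minimal_iff

end Probability

theorem constructUIG_eq_of_neighborSet {O : Type*} {K : Set O} (H : SimpleGraph K)
    {mb : K → Set O} (h : ∀ x, mb x = Subtype.val '' H.neighborSet x) :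
    constructUIG K mb = H := by
  ext x y
  have hmem : ∀ a b : K, (b : O) ∈ mb a ↔ H.Adj a b := fun a b => by simp [h]
  rw [constructUIG, SimpleGraph.fromRel_adj, hmem, hmem, H.adj_comm y x, or_self]
  exact ⟨fun h => h.2, fun h => ⟨h.ne, h⟩⟩

/-! ### The augmented graph of the marginal -/

namespace DirectedMixedGraph

variable {O : Type*} {G : DirectedMixedGraph O}

/-- The conditioning set to test is the set of ancestors of `a` and `b` in `K \ {a, b}`: all
vertices of a connecting path are then ancestors of `a` or `b`, so a non-collider in `K` would be
conditioned on. -/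
theorem Inseparable.exists_conn {K : Set O} {a b : O} (hab : a ≠ b) (h : G.Inseparable K a b) :
    ∃ m m', G.Conn Kᶜ (G.ancestors {a, b}) a m b m' := by
  obtain ⟨p, hp⟩ := not_mSep_singleton_iff.1
    (h (G.ancestors {a, b} ∩ (K \ {a, b})) Set.inter_subset_right)
  obtain ⟨m, m', h⟩ := hp.exists_conn hab
  have hsub : G.ancestors (G.ancestors {a, b} ∩ (K \ {a, b})) ⊆ G.ancestors {a, b} :=
    ancestors_subset_ancestors Set.inter_subset_left
  have hsub' : G.ancestors (insert a (insert b
      (G.ancestors (G.ancestors {a, b} ∩ (K \ {a, b}))))) ⊆ G.ancestors {a, b} := by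
    apply ancestors_subset_ancestors
    rintro c (rfl | rfl | hc)
    · exact subset_ancestors _ (by simp)
    · exact subset_ancestors _ (by simp)
    · exact hsub hc
  refine ⟨m, m', h.inter_ancestors.mono (fun c hc hcK => hc.1 ?_) hsub⟩
  by_cases hc' : c ∈ ({a, b} : Set O)
  · exact Or.inr hc'
  · exact Or.inl ⟨hsub' hc.2, hcK, hc'⟩

/-- Colliders above the endpoints can be rerouted whatever `Z` is. -/
theorem Conn.inseparable {K : Set O} {a b : O} {m m' : Bool} (hab : a ≠ b)
    (h : G.Conn Kᶜ (G.ancestors {a, b}) a m b m') : G.Inseparable K a b := by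
  intro Z hZ
  refine not_mSep_of_conn hab (Set.compl_subset_compl.2 (hZ.trans Set.sdiff_subset))
    (ancestors_mono ?_) h
  rintro c (rfl | rfl)
  · exact Or.inl rfl
  · exact Or.inr (Or.inr rfl)

/-- A tail at `b` would make `b` a proper ancestor of `a` or of itself. -/
theorem Conn.eq_true_of_not_ancEq (hG : G.IsAncestral) {N : Set O} {a b : O} {m m' : Bool}
    (h : G.Conn N (G.ancestors {a, b}) a m b m') (hba : ¬ G.AncEq b a) : m' = true := by
  by_contra hm
  obtain ⟨c, hc, hbc⟩ := h.exists_transGen_of_tail (by simpa using hm)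
  rcases hc with rfl | ⟨d, rfl | rfl, hcd⟩
  · exact hba hbc.to_reflTransGen
  · exact hba (hbc.to_reflTransGen.trans hcd)
  · exact hG.no_directed_cycle _ (hbc.trans_left hcd)

theorem marginal_into_iff (hG : G.IsAncestral) {K : Set O} {a b : K} :
    (G.marginal hG K).Into a b ↔
      a ≠ b ∧ G.Inseparable K a b ∧ ¬ G.AncEq (b : O) a := by
  constructor
  · rintro (h | h)
    · exact ⟨h.1, h.2.1, fun h' => h.1 (Subtype.ext (hG.ancEq_antisymm h.2.2 h'))⟩
    · exact ⟨h.1, h.2.1, h.2.2.2⟩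
  · rintro ⟨h1, h2, h3⟩
    by_cases h4 : G.AncEq (a : O) b
    · exact Or.inl ⟨h1, h2, h4⟩
    · exact Or.inr ⟨h1, h2, h4, h3⟩

theorem marginal_adj_iff (hG : G.IsAncestral) {K : Set O} {a b : K} :
    (G.marginal hG K).skeleton.Adj a b ↔ a ≠ b ∧ G.Inseparable K a b := by
  constructor
  · rintro (h | h | h)
    · exact ⟨h.1, h.2.1⟩
    · exact ⟨h.1.symm, h.2.1.symm⟩
    · exact ⟨h.1, h.2.1⟩
  · rintro ⟨h1, h2⟩
    by_cases h3 : G.AncEq (b : O) a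
    · exact Or.inr (Or.inl ⟨h1.symm, h2.symm, h3⟩)
    · exact ((marginal_into_iff hG).2 ⟨h1, h2, h3⟩).imp_right Or.inr

theorem marginal_adj_exists_conn (hG : G.IsAncestral) {K : Set O} {a b : K}
    (h : (G.marginal hG K).skeleton.Adj a b) : ∃ m m',
      G.Conn Kᶜ (G.ancestors {(a : O), (b : O)}) a m b m' ∧
      ((G.marginal hG K).Into b a → m = true) ∧ ((G.marginal hG K).Into a b → m' = true) := by
  obtain ⟨hab, hi⟩ := (marginal_adj_iff hG).1 h
  obtain ⟨m, m', h⟩ := hi.exists_conn fun h => hab (Subtype.ext h)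
  refine ⟨m, m', h, fun h' => ?_, fun h' => ?_⟩
  · have := h.symm
    rw [Set.pair_comm] at this
    exact this.eq_true_of_not_ancEq hG ((marginal_into_iff hG).1 h').2.2
  · exact h.eq_true_of_not_ancEq hG ((marginal_into_iff hG).1 h').2.2

/-- Marginal arrowheads force arrowheads on the underlying walks, so these meet in colliders
belonging to `K`. -/
theorem augmented_marginal_le (hG : G.IsAncestral) (K : Set O) :
    (G.marginal hG K).augmented ≤ G.independenceGraph K := by
  rintro x y ⟨hxy, p, -, hp⟩
  refine ⟨hxy, ?_⟩
  have hpair : ∀ a b : K, G.ancestors {(a : O), (b : O)} ⊆ G.ancestors K := fun a b =>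
    ancestors_mono (by rintro _ (rfl | rfl); exacts [a.2, b.2])
  have key : ∀ k, k + 1 ≤ p.length → ∃ m m', G.Conn Kᶜ (G.ancestors K) x m
      (p.getVert (k + 1)) m' ∧
      ((G.marginal hG K).Into (p.getVert k) (p.getVert (k + 1)) → m' = true) := by
    intro k
    induction k with
    | zero =>
      intro hk
      obtain ⟨m, m', h, -, h'⟩ :=
        marginal_adj_exists_conn hG (p.adj_getVert_succ (i := 0) (by omega))
      refine ⟨m, m', ?_, h'⟩
      have := h.mono subset_rfl (hpair _ _)
      simpa only [SimpleGraph.Walk.getVert_zero] using this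
    | succ k ih =>
      intro hk
      obtain ⟨m, m₁, h, hm₁⟩ := ih (by omega)
      obtain ⟨m₂, m', h', hm₂, hm'⟩ :=
        marginal_adj_exists_conn hG (p.adj_getVert_succ (i := k + 1) (by omega))
      refine ⟨m, m', h.trans (h'.mono subset_rfl (hpair _ _)) ?_, hm'⟩
      obtain ⟨hl, hr⟩ := hp k hk
      rw [hm₁ hl, hm₂ hr]
      exact markCond_collider (subset_ancestors _ (p.getVert (k + 1)).2)
  have hlen : p.length ≠ 0 := fun h => hxy (SimpleGraph.Walk.eq_of_length_eq_zero h)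
  obtain ⟨m, m', h, -⟩ := key (p.length - 1) (by omega)
  rw [show p.length - 1 + 1 = p.length by omega, p.getVert_length] at h
  exact ⟨m, m', h⟩

variable (G) in
/-- Consecutive vertices of the sequence `w` (up to index `n`) are connected by walks with all
non-colliders outside `K` and all colliders ancestors of the ends; at each non-endpoint of the
sequence, the two walks have arrowheads. -/
def IsInducingSeq (K : Set O) (w : ℕ → K) (n : ℕ) : Prop :=
  ∀ i < n, ∃ m m', G.Conn Kᶜ (G.ancestors {(w i : O), (w (i + 1) : O)}) (w i) m (w (i + 1)) m' ∧
    (i ≠ 0 → m = true) ∧ (i + 1 ≠ n → m' = true)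

theorem IsInducingSeq.cut {K : Set O} {w : ℕ → K} {n i j : ℕ} (h : G.IsInducingSeq K w n)
    (hij : i < j) (hjn : j ≤ n) (heq : w i = w j) :
    G.IsInducingSeq K (cutSeq w i j) (n - (j - i)) := by
  intro k hk
  rcases lt_or_ge k i with hki | hki
  · obtain ⟨m, m', hc, hm, hm'⟩ := h k (by omega)
    rw [cutSeq_of_le w hki.le, cutSeq_of_le w hki]
    exact ⟨m, m', hc, hm, fun _ => hm' (by omega)⟩
  · obtain ⟨m, m', hc, hm, hm'⟩ := h (k + (j - i)) (by omega)
    rw [cutSeq_of_ge heq hij hki, cutSeq_of_ge heq hij (by omega),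
      show k + 1 + (j - i) = k + (j - i) + 1 by omega]
    exact ⟨m, m', hc, fun _ => hm (by omega), fun _ => hm' (by omega)⟩

/-- A non-endpoint of an inducing sequence that is an ancestor of one of its neighbours can be
left out. -/
theorem IsInducingSeq.skip {K : Set O} {w : ℕ → K} {n i : ℕ} (h : G.IsInducingSeq K w n)
    (hi : i + 2 ≤ n)
    (hanc : (w (i + 1) : O) ∈ G.ancestors {(w i : O), (w (i + 2) : O)}) :
    G.IsInducingSeq K (fun k => if k ≤ i then w k else w (k + 1)) (n - 1) := by
  intro k hk
  rcases lt_trichotomy k i with hki | rfl | hki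
  · obtain ⟨m, m', hc, hm, hm'⟩ := h k (by omega)
    simp only [if_pos hki.le, if_pos (show k + 1 ≤ i from hki)]
    exact ⟨m, m', hc, hm, fun _ => hm' (by omega)⟩
  · obtain ⟨m, m₁, hc, hm, hm₁⟩ := h k (by omega)
    obtain ⟨m₂, m', hc', hm₂, hm'⟩ := h (k + 1) (by omega)
    obtain rfl := hm₁ (by omega)
    obtain rfl := hm₂ (by omega)
    simp only [if_pos le_rfl, if_neg (show ¬ k + 1 ≤ k by omega)]
    refine ⟨m, m', ?_, hm, fun _ => hm' (by omega)⟩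
    -- The omitted vertex becomes a collider above the new ends, and so do the colliders above it.
    refine (hc.mono subset_rfl ?_).trans (hc'.mono subset_rfl ?_) (markCond_collider hanc) <;>
    · apply ancestors_subset_ancestors
      rintro _ (rfl | rfl)
      · first | exact hanc | exact subset_ancestors _ (by simp)
      · first | exact hanc | exact subset_ancestors _ (by simp)
  · obtain ⟨m, m', hc, hm, hm'⟩ := h (k + 1) (by omega)
    simp only [if_neg (show ¬ k ≤ i by omega), if_neg (show ¬ k + 1 ≤ i by omega)]
    exact ⟨m, m', hc, fun _ => hm (by omega), fun _ => hm' (by omega)⟩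

/-- At each collider outside `K` the walk detours down to a closest vertex of `K` and back. That
vertex is entered by arrowheads from both sides and the old collider becomes a non-collider, so
breaking there leaves collider-free pieces. -/
theorem Conn.exists_isInducingSeq {K : Set O} {x y : K} {m m' : Bool}
    (h : G.Conn Kᶜ (G.ancestors K) x m y m') :
    ∃ n w, G.IsInducingSeq K w n ∧ w 0 = x ∧ w n = y := by
  have extend : ∀ (n : ℕ) (w : ℕ → K) (y : K) (m m' : Bool),
      (∀ i < n, ∃ m, G.Conn Kᶜ ∅ (w i : O) m (w (i + 1)) true ∧ (i ≠ 0 → m = true)) →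
      G.Conn Kᶜ ∅ (w n : O) m y m' →
      ∃ w' : ℕ → K, w' 0 = w 0 ∧ w' (n + 1) = y ∧
        (∀ i < n, ∃ m, G.Conn Kᶜ ∅ (w' i : O) m (w' (i + 1)) true ∧ (i ≠ 0 → m = true)) ∧
        G.Conn Kᶜ ∅ (w' n : O) m (w' (n + 1)) m' := by
    intro n w y m m' hw hc
    refine ⟨fun k => if k ≤ n then w k else y, by simp, by simp, fun i hi => ?_, by simpa using hc⟩
    simp only [if_pos hi.le, if_pos (show i + 1 ≤ n from hi)]
    exact hw i hi
  suffices H : ∀ (b : O) (m' : Bool), G.Conn Kᶜ (G.ancestors K) x m b m' → ∃ (n : ℕ) (w : ℕ → K),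
      (∀ i < n, ∃ m, G.Conn Kᶜ ∅ (w i : O) m (w (i + 1)) true ∧ (i ≠ 0 → m = true)) ∧
      w 0 = x ∧ ∃ m₁, G.Conn Kᶜ ∅ (w n : O) m₁ b m' ∧ (n ≠ 0 → m₁ = true) by
    obtain ⟨n, w, hw, h0, m₁, hc, hm₁⟩ := H y m' h
    obtain ⟨w', h0', hn', hw', hc'⟩ := extend n w y m₁ m' hw hc
    refine ⟨n + 1, w', fun i hi => ?_, h0'.trans h0, hn'⟩
    rcases Nat.lt_succ_iff_lt_or_eq.1 hi with hi | rfl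
    · obtain ⟨m, hc, hm⟩ := hw' i hi
      exact ⟨m, true, hc.mono subset_rfl (Set.empty_subset _), hm, fun _ => rfl⟩
    · exact ⟨m₁, m', hc'.mono subset_rfl (Set.empty_subset _), hm₁, fun h => absurd rfl h⟩
  intro b m' h
  induction h with
  | edge e => exact ⟨0, fun _ => x, fun i hi => by omega, rfl, m, .edge e, fun h => absurd rfl h⟩
  | @snoc b m₁ m₂ c m₃ _ e hc ih =>
    obtain ⟨n, w, hw, h0, m₀, hwb, hm₀⟩ := ih
    by_cases hcol : m₁ = true ∧ m₂ = true
    · obtain ⟨rfl, rfl⟩ := hcol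
      obtain ⟨k, hk, hbk⟩ := exists_closest_descendant (C := ∅) (hc.1 ⟨rfl, rfl⟩)
      have hl : G.Conn Kᶜ ∅ (w n : O) m₀ k true := by
        rcases hbk with rfl | ⟨hb, hbk⟩
        · exact hwb
        · exact hwb.trans hbk (markCond_tail_right hb)
      have hr : G.Conn Kᶜ ∅ k true c m₃ := by
        rcases hbk with rfl | ⟨hb, hbk⟩
        · exact .edge e
        · exact .snoc hbk.symm e (markCond_tail_left hb)
      obtain ⟨w', h0', hn', hw', hc'⟩ := extend n w ⟨k, hk⟩ m₀ true hw hl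
      refine ⟨n + 1, w', fun i hi => ?_, h0'.trans h0, true, by rw [hn']; exact hr, fun _ => rfl⟩
      rcases Nat.lt_succ_iff_lt_or_eq.1 hi with hi | rfl
      · exact hw' i hi
      · exact ⟨m₀, hc', hm₀⟩
    · exact ⟨n, w, hw, h0, m₀, .snoc hwb e ⟨fun h => absurd h hcol, hc.2⟩, hm₀⟩

theorem independenceGraph_le_augmented_marginal (hG : G.IsAncestral) (K : Set O) :
    G.independenceGraph K ≤ (G.marginal hG K).augmented := by
  classical
  rintro x y ⟨hxy, m, m', h⟩
  refine ⟨hxy, ?_⟩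
  have hex : ∃ n w, G.IsInducingSeq K w n ∧ w 0 = x ∧ w n = y := h.exists_isInducingSeq
  obtain ⟨w, hw, h0, hn⟩ := Nat.find_spec hex
  have hmin : ∀ k < Nat.find hex, ¬ _ := fun k hk => Nat.find_min hex hk
  generalize Nat.find hex = n at *
  have hne : ∀ i j, i < j → j ≤ n → w i ≠ w j := by
    intro i j hij hjn heq
    refine hmin (n - (j - i)) (by omega)
      ⟨cutSeq w i j, hw.cut hij hjn heq, by rw [cutSeq_of_le w (by omega), h0], ?_⟩
    rw [cutSeq_of_ge heq hij (by omega), ← hn]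
    congr 1
    omega
  have hinj : Set.InjOn w {i | i ≤ n} := by
    intro i hi j hj hij
    rcases lt_trichotomy i j with h | h | h
    · exact absurd hij (hne i j h hj)
    · exact h
    · exact absurd hij.symm (hne j i h hi)
  have hins : ∀ i < n, w i ≠ w (i + 1) ∧ G.Inseparable K (w i) (w (i + 1)) := by
    intro i hi
    obtain ⟨m, m', hc, -, -⟩ := hw i hi
    have := hne i (i + 1) (by omega) hi
    exact ⟨this, hc.inseparable fun h => this (Subtype.ext h)⟩
  -- Otherwise `skip` would give a shorter sequence; this is what puts both marginal arrowheads at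
  -- `w (i + 1)`.
  have hanc : ∀ i, i + 2 ≤ n →
      (w (i + 1) : O) ∉ G.ancestors {(w i : O), (w (i + 2) : O)} := by
    intro i hi ha
    refine hmin (n - 1) (by omega) ⟨_, hw.skip hi ha, by simpa using h0, ?_⟩
    simp only [if_neg (show ¬ n - 1 ≤ i by omega), show n - 1 + 1 = n by omega, hn]
  obtain ⟨p, hp, hlen, hv⟩ := (G.marginal hG K).skeleton.exists_path_getVert_eq w n
    (fun i hi => (marginal_adj_iff hG).2 (hins i hi)) hinj
  subst h0 hn
  refine ⟨p, hp, fun i hi => ?_⟩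
  rw [hlen] at hi
  unfold IsColliderAt
  rw [hv i (by omega), hv (i + 1) (by omega), hv (i + 2) (by omega), marginal_into_iff,
    marginal_into_iff]
  obtain ⟨h1, h2⟩ := hins i (by omega)
  obtain ⟨h3, h4⟩ := hins (i + 1) (by omega)
  exact ⟨⟨h1, h2, fun h => hanc i hi ⟨_, by simp, h⟩⟩,
    ⟨h3.symm, h4.symm, fun h => hanc i hi ⟨_, by simp, h⟩⟩⟩

theorem independenceGraph_eq_augmented_marginal (hG : G.IsAncestral) (K : Set O) :
    G.independenceGraph K = (G.marginal hG K).augmented :=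
  le_antisymm (independenceGraph_le_augmented_marginal hG K) (augmented_marginal_le hG K)

end DirectedMixedGraph

theorem mainTheorem7 {O : Type*} [Finite O] (G : DirectedMixedGraph O) (hG : G.IsMAG)
    {Ω : Type*} [MeasurableSpace Ω] [StandardBorelSpace Ω]
    (μ : MeasureTheory.Measure Ω) [MeasureTheory.IsProbabilityMeasure μ]
    {E : O → Type*} [∀ i, MeasurableSpace (E i)]
    (V : ∀ i, Ω → E i) (hV : ∀ i, Measurable (V i))
    (hMarkov : CausalMarkov μ G hV) (hFaithful : CausalFaithful μ G hV) (K : Set O) :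
    (∀ x ∈ K, ∃! B : Set O, IsMarkovBlanket μ hV K x B) ∧
    ∀ mb : K → Set O, (∀ x : K, IsMarkovBlanket μ hV K x (mb x)) →
      G.IsUIG K (constructUIG K mb) ∧
      G.IsMinimalUIG K (constructUIG K mb) ∧
      constructUIG K mb = (G.marginal hG.toIsAncestral K).augmented := by
  refine ⟨fun x hx => ?_, fun mb hmb => ?_⟩
  · have h := isMarkovBlanket_iff hMarkov hFaithful ⟨x, hx⟩
    exact ⟨_, (h _).2 rfl, fun B hB => (h B).1 hB⟩
  · rw [constructUIG_eq_of_neighborSet (G.independenceGraph K) fun x =>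
      (isMarkovBlanket_iff hMarkov hFaithful x _).1 (hmb x)]
    exact ⟨DirectedMixedGraph.isUIG_independenceGraph K,
      DirectedMixedGraph.isMinimalUIG_independenceGraph K,
      DirectedMixedGraph.independenceGraph_eq_augmented_marginal _ K⟩
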